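/- For a finite group $G$, let the power graph $\mathcal P(G)$ be the simple undirected graph with vertex set $G$ in which two distinct elements $g,h$ are adjacent if and only if $h\in\langle g\rangle$ or $g\in\langle h\rangle$, and let $E(G)$ be its edge set. Let $\mathbb Z_n$ denote the cyclic group of order $n$. Let $G$ be a finite group and let $n\ge 1$ be an integer. Consider the conditions (i) $\mathcal P(G)\cong\mathcal P(\mathbb Z_n)$ (isomorphism of graphs); (ii) $|E(G)|=|E(\mathbb Z_n)|$; (iii) $G\cong\mathbb Z_n$ (isomorphism of groups). Then (i) and (iii) are equivalent, and (i) implies (ii). If moreover $|G|=n$, then (i), (ii) and (iii) are equivalent. -/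

import Mathlib

/-- The directed power graph of a group: there is an edge from `g` to `h` whenever `h` lies in the
cyclic subgroup generated by `g` and `h` is distinct from `g`. -/
def directedPowerGraph (G : Type*) [Group G] : Digraph G where
  Adj g h := h ∈ Subgroup.zpowers g ∧ h ≠ g

/-- The undirected power graph of a group: `g` and `h` are adjacent whenever the directed power
graph has an edge from one of them to the other. -/
def powerGraph (G : Type*) [Group G] : SimpleGraph G where
  Adj g h := (directedPowerGraph G).Adj g h ∨ (directedPowerGraph G).Adj h g
  symm := ⟨fun _ _ => Or.symm⟩
  loopless := ⟨fun _ h => h.elim (fun h => h.2 rfl) (fun h => h.2 rfl)⟩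

/-- The number of edges of the power graph of a group (a finite group, where it is used). -/
noncomputable def powerGraphEdgeCount (G : Type*) [Group G] : ℕ :=
  (powerGraph G).edgeSet.ncard

open Finset

/-! Counting edges turns `2|E| + |G|` into the sum of `2 o(g) - φ(o(g))` over `G`
(`two_mul_powerGraphEdgeCount`), so it suffices that among groups of order `n` only the cyclic one
maximises this sum (`sum_orderWeight_lt`). Let `p` be the largest prime factor of `n`. If all orders
are at most `n / p`, the sum is too small by `two_mul_sq_le_edge_sum`. Otherwise some cyclic
subgroup has index below `p`, which forces a normal cyclic Sylow `p`-subgroup `P`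
(`exists_normal_cyclic_sylow`) with a complement `H`. Since `o(ux)` divides `o(u) o(x)` and the
weight increases along divisibility, the sum is bounded by sums over `H`, and induction applies. -/

/-! ### Arithmetic of the cyclic sums -/

/-- The sum of the orders of the elements of a cyclic group of order `n`. -/
def cyclicOrderSum (n : ℕ) : ℕ := ∑ d ∈ n.divisors, d.totient * d

/-- The sum of the totients of the orders of the elements of a cyclic group of order `n`. -/
def cyclicTotientSum (n : ℕ) : ℕ := ∑ d ∈ n.divisors, d.totient * d.totient

theorem sum_divisors_mul_of_coprime {m n : ℕ} (h : m.Coprime n) (f : ℕ → ℕ)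
    (hf : ∀ a b : ℕ, a.Coprime b → f (a * b) = f a * f b) :
    ∑ d ∈ (m * n).divisors, f d = (∑ d ∈ m.divisors, f d) * ∑ d ∈ n.divisors, f d := by
  rw [sum_mul_sum, ← sum_product', h.divisors_mul, sum_map,
    ← sum_attach (m.divisors ×ˢ n.divisors)]
  refine sum_congr rfl fun x _ => ?_
  have hx := mem_product.1 x.2
  exact hf _ _ ((h.coprime_dvd_left (Nat.dvd_of_mem_divisors hx.1)).coprime_dvd_right
    (Nat.dvd_of_mem_divisors hx.2))

theorem cyclicOrderSum_mul {m n : ℕ} (h : m.Coprime n) :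
    cyclicOrderSum (m * n) = cyclicOrderSum m * cyclicOrderSum n :=
  sum_divisors_mul_of_coprime h _ fun a b hab => by rw [Nat.totient_mul hab]; ring

theorem cyclicTotientSum_mul {m n : ℕ} (h : m.Coprime n) :
    cyclicTotientSum (m * n) = cyclicTotientSum m * cyclicTotientSum n :=
  sum_divisors_mul_of_coprime h _ fun a b hab => by rw [Nat.totient_mul hab]; ring

theorem cyclicTotientSum_le (n : ℕ) : cyclicTotientSum n ≤ cyclicOrderSum n :=
  sum_le_sum fun d _ => Nat.mul_le_mul_left _ (Nat.totient_le d)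

theorem succ_mul_cyclicOrderSum_prime_pow {p : ℕ} (hp : p.Prime) (e : ℕ) :
    (p + 1) * cyclicOrderSum (p ^ e) = p ^ (2 * e + 1) + 1 := by
  unfold cyclicOrderSum
  rw [Nat.sum_divisors_prime_pow hp]
  obtain ⟨q, rfl⟩ : ∃ q, p = q + 1 := ⟨p - 1, by have := hp.pos; omega⟩
  induction e with
  | zero => simp
  | succ e ih =>
    rw [sum_range_succ, mul_add, ih, Nat.totient_prime_pow_succ hp, Nat.add_sub_cancel]
    ring

theorem succ_mul_cyclicTotientSum_prime_pow {p : ℕ} (hp : p.Prime) (e : ℕ) :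
    (p + 1) * cyclicTotientSum (p ^ e) = (p - 1) * p ^ (2 * e) + 2 := by
  unfold cyclicTotientSum
  rw [Nat.sum_divisors_prime_pow hp]
  obtain ⟨q, rfl⟩ : ∃ q, p = q + 1 := ⟨p - 1, by have := hp.pos; omega⟩
  induction e with
  | zero => simp
  | succ e ih =>
    rw [sum_range_succ, mul_add, ih, Nat.totient_prime_pow_succ hp, Nat.add_sub_cancel]
    ring

/-- If the prime factors of `n` lie in `[q, k)`, then the order sum of the cyclic group of
order `n` is at least `q * n ^ 2 / k`. -/
theorem mul_sq_le_cyclicOrderSum {q k : ℕ} (hqk : q ≤ k) :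
    ∀ n : ℕ, n ≠ 0 → (∀ p, p.Prime → p ∣ n → q ≤ p ∧ p < k) →
      q * n ^ 2 ≤ cyclicOrderSum n * k := by
  induction k, hqk using Nat.le_induction with
  | base =>
    intro n hn h
    obtain rfl : n = 1 := by
      by_contra h1
      obtain ⟨p, hp, hpn⟩ := Nat.exists_prime_and_dvd h1
      have := h p hp hpn
      omega
    simp [cyclicOrderSum]
  | succ k hqk ih =>
    intro n hn h
    by_cases hk : k.Prime ∧ k ∣ n
    · obtain ⟨hk, -⟩ := hk
      obtain ⟨e, m, hm, rfl⟩ := Nat.exists_eq_pow_mul_and_not_dvd hn k hk.ne_one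
      have hcop : (k ^ e).Coprime m := ((Nat.Prime.coprime_iff_not_dvd hk).2 hm).pow_left e
      have h1 := ih m (right_ne_zero_of_mul hn) fun p hp hpm => by
        have h2 := h p hp (hpm.mul_left _)
        have h3 : p ≠ k := by rintro rfl; exact hm hpm
        omega
      rw [cyclicOrderSum_mul hcop]
      -- A prime `k` costs a factor `k / (k + 1)`; charging every integer of the interval makes the
      -- product telescope.
      calc q * (k ^ e * m) ^ 2 = k ^ (2 * e) * (q * m ^ 2) := by ring
        _ ≤ k ^ (2 * e) * (cyclicOrderSum m * k) := by gcongr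
        _ = k ^ (2 * e + 1) * cyclicOrderSum m := by ring
        _ ≤ ((k + 1) * cyclicOrderSum (k ^ e)) * cyclicOrderSum m := by
          rw [succ_mul_cyclicOrderSum_prime_pow hk]
          gcongr
          omega
        _ = _ := by ring
    · refine (ih n hn fun p hp hpn => ?_).trans (by gcongr; omega)
      have h2 := h p hp hpn
      have h3 : p ≠ k := by rintro rfl; exact hk ⟨hp, hpn⟩
      omega

/-- The 2-part alone supplies the factor 2/3, with equality there at exponent 1. -/
theorem three_mul_cyclicTotientSum_le {n : ℕ} (hn : n ≠ 0) (h : 2 ∣ n) :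
    3 * cyclicTotientSum n ≤ 2 * cyclicOrderSum n := by
  obtain ⟨e, m, hm, rfl⟩ := Nat.exists_eq_pow_mul_and_not_dvd hn 2 (by norm_num)
  have he : e ≠ 0 := by rintro rfl; simp at h; omega
  have hcop : (2 ^ e).Coprime m := ((Nat.Prime.coprime_iff_not_dvd Nat.prime_two).2 hm).pow_left e
  rw [cyclicOrderSum_mul hcop, cyclicTotientSum_mul hcop, ← mul_assoc, ← mul_assoc]
  refine Nat.mul_le_mul ?_ (cyclicTotientSum_le m)
  have h1 := succ_mul_cyclicOrderSum_prime_pow Nat.prime_two e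
  have h2 := succ_mul_cyclicTotientSum_prime_pow Nat.prime_two e
  have h3 : 2 ^ (2 * 1) ≤ 2 ^ (2 * e) := Nat.pow_le_pow_right (by norm_num) (by omega)
  rw [pow_succ] at h1
  omega

/-- For `p` the largest prime factor of `n`, the edge sum of the cyclic group of order `n` is at
least `2 * n ^ 2 / p`. -/
theorem two_mul_sq_le_edge_sum {n p : ℕ} (hn : n ≠ 0) (hp : p.Prime) (hpn : p ∣ n)
    (hmax : ∀ q, q.Prime → q ∣ n → q ≤ p) :
    2 * n ^ 2 + p * cyclicTotientSum n ≤ p * (2 * cyclicOrderSum n) := by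
  by_cases h2 : 2 ∣ n
  -- If `p = 2`, then `n` is a power of 2 and equality holds, so the closed forms are needed.
  · rcases hp.eq_two_or_odd' with rfl | hodd
    · obtain ⟨e, m, hm, rfl⟩ := Nat.exists_eq_pow_mul_and_not_dvd hn 2 (by norm_num)
      obtain rfl : m = 1 := by
        by_contra h1
        obtain ⟨q, hq, hqm⟩ := Nat.exists_prime_and_dvd h1
        have h3 := hmax q hq (hqm.mul_left _)
        have h4 := hq.two_le
        obtain rfl : q = 2 := by omega
        exact hm hqm
      have h1 := succ_mul_cyclicOrderSum_prime_pow Nat.prime_two e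
      have h2 := succ_mul_cyclicTotientSum_prime_pow Nat.prime_two e
      rw [mul_one, ← pow_mul, mul_comm e 2]
      rw [pow_succ] at h1
      omega
    · have hp3 : 3 ≤ p := by
        obtain ⟨k, rfl⟩ := hodd
        have := hp.two_le
        omega
      have h1 := mul_sq_le_cyclicOrderSum (q := 2) (k := p + 1) (by omega) n hn fun q hq hqn =>
        ⟨hq.two_le, Nat.lt_succ_of_le (hmax q hq hqn)⟩
      have h3 := three_mul_cyclicTotientSum_le hn h2
      -- The edge sum is at least `(4/3) * 2n² / (p + 1)`, which is at least `2n² / p` once `p ≥ 3`.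
      nlinarith [Nat.mul_le_mul_left p h3, Nat.mul_le_mul_right (cyclicOrderSum n) hp3]
  · have h1 := mul_sq_le_cyclicOrderSum (q := 3) (k := p + 1)
      (by
        have h3 := hp.two_le
        omega) n hn fun q hq hqn => by
        have h3 := hq.two_le
        have h4 : q ≠ 2 := by rintro rfl; exact h2 hqn
        have h5 := hmax q hq hqn
        omega
    have h3 := cyclicTotientSum_le n
    nlinarith [Nat.mul_le_mul_left p h3, Nat.mul_le_mul_right (cyclicOrderSum n) hp.two_le]

/-! ### Order weights -/

/-- The weight `a * d - b * φ d` of an element of order `d`. For `a = 2` and `b = 1`, its sum over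
a finite group counts ordered pairs of equal or adjacent elements in the power graph. -/
def orderWeight (a b : ℤ) (d : ℕ) : ℤ := a * d - b * d.totient

/-- As `φ(e) ≤ e` and `e ≥ 2d`, the weight of `e` is at least `2(a - b)d ≥ ad`. Strictness comes
from `b φ(d) > 0`, or from `e > d` when `b = 0`. -/
theorem orderWeight_lt {a b : ℤ} (ha : 0 < a) (hb : 0 ≤ b) (hab : 2 * b ≤ a) {d e : ℕ}
    (he : e ≠ 0) (hde : d ∣ e) (hne : d ≠ e) : orderWeight a b d < orderWeight a b e := by
  obtain ⟨k, rfl⟩ := hde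
  have hd : 0 < d := Nat.pos_of_ne_zero (left_ne_zero_of_mul he)
  have hk : 2 ≤ k := by
    have := right_ne_zero_of_mul he
    have : k ≠ 1 := by rintro rfl; simp at hne
    omega
  unfold orderWeight
  have h1 : ((d * k).totient : ℤ) ≤ d * k := by exact_mod_cast Nat.totient_le _
  have h2 : (0 : ℤ) < d.totient := by exact_mod_cast Nat.totient_pos.2 hd
  have h3 : (2 : ℤ) ≤ k := by exact_mod_cast hk
  have hd' : (0 : ℤ) < d := by exact_mod_cast hd
  have h4 : b * (d * k).totient ≤ b * (d * k) := mul_le_mul_of_nonneg_left h1 hb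
  have h5 : (d : ℤ) * 2 ≤ d * k := mul_le_mul_of_nonneg_left h3 hd'.le
  push_cast
  rcases hb.eq_or_lt with rfl | hb
  · nlinarith
  · have h6 : 0 < b * (d.totient : ℤ) := mul_pos hb h2
    have h7 : (a - b) * (d * 2) ≤ (a - b) * (d * k) := mul_le_mul_of_nonneg_left h5 (by linarith)
    nlinarith

theorem orderWeight_le {a b : ℤ} (ha : 0 < a) (hb : 0 ≤ b) (hab : 2 * b ≤ a) {d e : ℕ}
    (he : e ≠ 0) (hde : d ∣ e) : orderWeight a b d ≤ orderWeight a b e := by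
  rcases eq_or_ne d e with rfl | hne
  · rfl
  · exact (orderWeight_lt ha hb hab he hde hne).le

theorem sum_orderOf_eq_of_isCyclic {G : Type*} [Group G] [Fintype G] [IsCyclic G] (f : ℕ → ℤ) :
    ∑ g : G, f (orderOf g) = ∑ d ∈ (Nat.card G).divisors, d.totient * f d := by
  rw [← sum_fiberwise_of_maps_to (s := univ) (t := (Nat.card G).divisors) (g := fun g : G => orderOf g)
    fun g _ => Nat.mem_divisors.2 ⟨orderOf_dvd_natCard g, Nat.card_pos.ne'⟩]
  refine sum_congr rfl fun d hd => ?_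
  rw [sum_congr rfl fun g hg => by rw [(mem_filter.1 hg).2], sum_const,
    IsCyclic.card_orderOf_eq_totient (Nat.card_eq_fintype_card (α := G) ▸ Nat.dvd_of_mem_divisors hd),
    nsmul_eq_mul]

theorem sum_orderWeight_of_isCyclic (G : Type*) [Group G] [Fintype G] [IsCyclic G] (a b : ℤ) :
    ∑ g : G, orderWeight a b (orderOf g) =
      a * cyclicOrderSum (Nat.card G) - b * cyclicTotientSum (Nat.card G) := by
  rw [sum_orderOf_eq_of_isCyclic, cyclicOrderSum, cyclicTotientSum]
  push_cast
  rw [mul_sum, mul_sum, ← sum_sub_distrib]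
  exact sum_congr rfl fun d _ => by rw [orderWeight]; ring

/-! ### Normal cyclic subgroups and Sylow subgroups -/

theorem zpowers_normal_of_mem {G : Type*} [Group G] {P : Subgroup G} [P.Normal] [IsCyclic P]
    {u : G} (hu : u ∈ P) : (Subgroup.zpowers u).Normal := by
  obtain ⟨⟨x, hx⟩, hgen⟩ := IsCyclic.exists_generator (α := P)
  have key : ∀ y ∈ P, ∃ k : ℤ, x ^ k = y := fun y hy => by
    obtain ⟨k, hk⟩ := Subgroup.mem_zpowers_iff.1 (hgen ⟨y, hy⟩)
    exact ⟨k, congrArg Subtype.val hk⟩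
  refine ⟨fun v hv g => ?_⟩
  obtain ⟨l, rfl⟩ := Subgroup.mem_zpowers_iff.1 hv
  obtain ⟨k, rfl⟩ := key u hu
  obtain ⟨t, ht⟩ := key (g * x * g⁻¹) (Subgroup.Normal.conj_mem inferInstance x hx g)
  refine Subgroup.mem_zpowers_iff.2 ⟨l * t, ?_⟩
  rw [← conj_zpow, ← conj_zpow, ← ht, ← zpow_mul, ← zpow_mul, ← zpow_mul]
  congr 1
  ring

/-- Modulo the normal subgroup `⟨u⟩`, the elements `ux` and `x` coincide. -/
theorem orderOf_mul_dvd_of_mem {G : Type*} [Group G] {P : Subgroup G} [P.Normal] [IsCyclic P]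
    (x : G) {u : G} (hu : u ∈ P) : orderOf (u * x) ∣ orderOf u * orderOf x := by
  have hN := zpowers_normal_of_mem hu
  have h : (u * x) ^ orderOf x ∈ Subgroup.zpowers u := by
    rw [← QuotientGroup.eq_one_iff, QuotientGroup.mk_pow, QuotientGroup.mk_mul,
      (QuotientGroup.eq_one_iff u).2 (Subgroup.mem_zpowers u), one_mul, ← QuotientGroup.mk_pow,
      pow_orderOf_eq_one, QuotientGroup.mk_one]
  rw [mul_comm]
  refine orderOf_dvd_of_pow_eq_one ?_
  rw [pow_mul]
  exact orderOf_dvd_iff_pow_eq_one.1 (orderOf_dvd_of_mem_zpowers h)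

/-- A cyclic subgroup of index less than a prime `p` contains a normal Sylow `p`-subgroup. -/
theorem exists_normal_cyclic_sylow {G : Type*} [Group G] [Finite G] {p : ℕ} [hp : Fact p.Prime]
    {g : G} (hg : Nat.card G < orderOf g * p) :
    ∃ P : Subgroup G, P.Normal ∧ IsCyclic P ∧ Nat.card P = p ^ (Nat.card G).factorization p := by
  have hidx := (Subgroup.zpowers g).card_mul_index
  rw [Nat.card_zpowers] at hidx
  have hlt : (Subgroup.zpowers g).index < p := by
    rw [← hidx] at hg
    exact lt_of_mul_lt_mul_left hg (Nat.zero_le _)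
  have hpos : 0 < (Subgroup.zpowers g).index := Nat.pos_of_ne_zero Subgroup.FiniteIndex.index_ne_zero
  have hnd : ¬ p ∣ (Subgroup.zpowers g).index := Nat.not_dvd_of_pos_of_lt hpos hlt
  have hdvd : p ^ (Nat.card G).factorization p ∣ orderOf g := by
    have h1 := Nat.ordProj_dvd (Nat.card G) p
    rw [← hidx] at h1 ⊢
    exact (((Nat.Prime.coprime_iff_not_dvd hp.out).2 hnd).pow_left _).dvd_of_dvd_mul_right h1
  obtain ⟨k, hk⟩ := hdvd
  have hcard : Nat.card (Subgroup.zpowers (g ^ k)) = p ^ (Nat.card G).factorization p := by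
    rw [Nat.card_zpowers]
    have hk0 : k ≠ 0 := by
      rintro rfl
      exact (orderOf_pos g).ne' hk
    rw [orderOf_pow_of_dvd hk0 (hk ▸ dvd_mul_left _ _), hk,
      Nat.mul_div_cancel _ (Nat.pos_of_ne_zero hk0)]
  let Q : Sylow p G := Sylow.ofCard _ hcard
  have hQ : (Q : Subgroup G) = Subgroup.zpowers (g ^ k) := rfl
  refine ⟨Q, ?_, ?_, hcard⟩
  -- The number of Sylow `p`-subgroups is the index of this normalizer: it is below `p` and
  -- congruent to 1 mod `p`, hence 1.
  · have hle : Subgroup.zpowers g ≤ Subgroup.normalizer (Q : Set G) := by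
      rw [Subgroup.zpowers_le]
      refine (Subgroup.centralizer_le_normalizer (Q : Set G)) ?_
      rw [Subgroup.mem_centralizer_iff]
      intro h hh
      obtain ⟨l, rfl⟩ := Subgroup.mem_zpowers_iff.1 (show h ∈ Subgroup.zpowers (g ^ k) from hh)
      exact (((Commute.refl g).pow_left k).zpow_left l).eq
    have h1 := Sylow.card_eq_index_normalizer Q
    have h2 := Nat.le_of_dvd hpos (Subgroup.index_dvd_of_le hle)
    have h3 := card_sylow_modEq_one p G
    rw [h1] at h3
    have h4 : (Subgroup.normalizer (Q : Set G)).index = 1 :=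
      h3.eq_of_lt_of_lt (h2.trans_lt hlt) hp.out.one_lt
    exact Subgroup.normalizer_eq_top_iff.1 (Subgroup.index_eq_one.1 h4)
  · rw [hQ]; infer_instance

/-! ### Maximality of the cyclic group -/

/-- If every element has order at most `n / p`, with `p` the largest prime factor of `n`, then the
weight sum is less than that of the cyclic group of order `n`. -/
theorem sum_orderWeight_lt_of_orderOf_le {G : Type*} [Group G] [Fintype G] {a b : ℤ} (ha : 0 < a)
    (hb : 0 ≤ b) (hab : 2 * b ≤ a) {p : ℕ} (hp : p.Prime) (hpn : p ∣ Nat.card G)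
    (hmax : ∀ q, q.Prime → q ∣ Nat.card G → q ≤ p) (hcyc : ¬ IsCyclic G)
    (hle : ∀ g : G, orderOf g * p ≤ Nat.card G) :
    ∑ g : G, orderWeight a b (orderOf g) <
      a * cyclicOrderSum (Nat.card G) - b * cyclicTotientSum (Nat.card G) := by
  have h1 := two_mul_sq_le_edge_sum Nat.card_pos.ne' hp hpn hmax
  have h2 := cyclicTotientSum_le (Nat.card G)
  have hlt : (1 : ℤ) * p < Nat.card G := by
    rw [one_mul]
    norm_cast
    refine lt_of_le_of_ne (Nat.le_of_dvd Nat.card_pos hpn) fun h => hcyc ?_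
    have : Fact p.Prime := ⟨hp⟩
    exact isCyclic_of_prime_card h.symm
  have hp0 : (0 : ℤ) < p := by exact_mod_cast hp.pos
  have h3 : p * ∑ g : G, orderWeight a b (orderOf g) < a * (Nat.card G) ^ 2 := by
    have h4 : ∑ g : G, p * orderWeight a b (orderOf g) < ∑ g : G, a * (Nat.card G : ℤ) := by
      refine sum_lt_sum (fun g _ => ?_) ⟨1, mem_univ _, ?_⟩
      · have h5 : ((orderOf g : ℤ)) * p ≤ Nat.card G := by exact_mod_cast hle g
        have h6 : 0 ≤ p * (b * ((orderOf g).totient : ℤ)) := by positivity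
        have := mul_le_mul_of_nonneg_left h5 ha.le
        rw [orderWeight]
        linarith
      · have h6 : 0 ≤ p * b := by positivity
        have := mul_lt_mul_of_pos_left hlt ha
        simp only [orderOf_one, orderWeight, Nat.totient_one, Nat.cast_one]
        linarith
    rw [mul_sum]
    refine h4.trans_eq ?_
    rw [sum_const, card_univ, ← Nat.card_eq_fintype_card, nsmul_eq_mul]
    ring
  refine lt_of_mul_lt_mul_left (h3.trans_le ?_) hp0.le
  zify at h1 h2
  -- With `S`, `T` the two cyclic sums, `2(aS - bT) = a(2S - T) + (a - 2b)T` reduces to `a = 2`, `b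
  -- = 1`.
  have h7 : 0 ≤ (a - 2 * b) * (p * (cyclicTotientSum (Nat.card G) : ℤ)) :=
    mul_nonneg (by linarith) (by positivity)
  nlinarith [mul_le_mul_of_nonneg_left h1 ha.le]

theorem isCyclic_of_orderOf_mul_eq {G : Type*} [Group G] [Finite G] {P H : Subgroup G}
    (hcomp : P.IsComplement' H) [IsCyclic P] [IsCyclic H]
    (h : ∀ (u : P) (x : H), orderOf ((u : G) * x) = orderOf u * orderOf x) : IsCyclic G := by
  obtain ⟨u, hu⟩ := IsCyclic.exists_ofOrder_eq_natCard (α := P)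
  obtain ⟨x, hx⟩ := IsCyclic.exists_ofOrder_eq_natCard (α := H)
  refine isCyclic_of_orderOf_eq_card ((u : G) * x) ?_
  rw [h, hu, hx, hcomp.card_mul_card]

/-- Among the finite groups of a given order, only the cyclic one attains the maximum of
the weight sum. -/
theorem sum_orderWeight_lt (n : ℕ) : ∀ {G : Type*} [Group G] [Fintype G] {a b : ℤ}, 0 < a →
    0 ≤ b → 2 * b ≤ a → Nat.card G = n → ¬ IsCyclic G →
    ∑ g : G, orderWeight a b (orderOf g) < a * cyclicOrderSum n - b * cyclicTotientSum n := by
  induction n using Nat.strong_induction_on with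
  | _ n ih =>
  intro G _ _ a b ha hb hab hn hcyc
  have hn1 : n ≠ 1 := by
    rintro rfl
    have := (Nat.card_eq_one_iff_unique.1 hn).1
    exact hcyc inferInstance
  have hn0 : n ≠ 0 := hn ▸ Nat.card_pos.ne'
  obtain ⟨p, hp, hpn, hmax⟩ : ∃ p, p.Prime ∧ p ∣ n ∧ ∀ q, q.Prime → q ∣ n → q ≤ p := by
    have hne : n.primeFactors.Nonempty := Nat.nonempty_primeFactors.2 (by omega)
    have hmem := Nat.mem_primeFactors.1 (n.primeFactors.max'_mem hne)
    exact ⟨_, hmem.1, hmem.2.1, fun q hq hqn =>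
      n.primeFactors.le_max' q (Nat.mem_primeFactors.2 ⟨hq, hqn, hn0⟩)⟩
  by_cases hle : ∀ g : G, orderOf g * p ≤ Nat.card G
  · subst hn
    exact sum_orderWeight_lt_of_orderOf_le ha hb hab hp hpn hmax hcyc hle
  push Not at hle
  obtain ⟨g, hg⟩ := hle
  have : Fact p.Prime := ⟨hp⟩
  obtain ⟨P, hPn, hPc, hPcard⟩ := exists_normal_cyclic_sylow hg
  rw [hn] at hPcard
  have hPidx := P.card_mul_index
  rw [hn] at hPidx
  have hPgt : 1 < Nat.card P := by
    rw [hPcard]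
    exact Nat.one_lt_pow (hp.factorization_pos_of_dvd hn0 hpn).ne' hp.one_lt
  have hcop : (Nat.card P).Coprime P.index := by
    have h1 := Nat.coprime_ordCompl hp hn0
    have h2 : P.index = n / p ^ n.factorization p := by
      rw [← hPcard, ← hPidx, Nat.mul_div_cancel_left _ (by omega)]
    rw [h2, hPcard]
    exact h1.pow_left _
  obtain ⟨H, hcomp⟩ := Subgroup.exists_right_complement'_of_coprime hcop
  have hidx : P.index = Nat.card H := hcomp.symm.index_eq_card
  rw [hidx] at hPidx hcop
  have hHlt : Nat.card H < n := by
    rw [← hPidx]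
    exact lt_mul_of_one_lt_left Nat.card_pos hPgt
  classical
  -- For fixed `u` this is again a weight in `o(x)`, with other coefficients; hence the induction
  -- over all `a`, `b`.
  have hsplit : ∀ (u : P) (x : H), orderWeight a b (orderOf u * orderOf x) =
      orderWeight (a * orderOf u) (b * (orderOf u).totient) (orderOf x) := fun u x => by
    rw [orderWeight, orderWeight, Nat.totient_mul ((hcop.coprime_dvd_left
      (orderOf_dvd_natCard u)).coprime_dvd_right (orderOf_dvd_natCard x))]
    push_cast
    ring
  have hdvd : ∀ (u : P) (x : H), orderOf ((u : G) * x) ∣ orderOf u * orderOf x := fun u x => by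
    simpa only [Subgroup.orderOf_coe] using orderOf_mul_dvd_of_mem (x : G) u.2
  have hne0 : ∀ (u : P) (x : H), orderOf u * orderOf x ≠ 0 := fun u x =>
    (Nat.mul_pos (orderOf_pos u) (orderOf_pos x)).ne'
  have hG : ∑ g : G, orderWeight a b (orderOf g) =
      ∑ u : P, ∑ x : H, orderWeight a b (orderOf ((u : G) * x)) := by
    rw [← Fintype.sum_prod_type']
    exact (Fintype.sum_bijective _ hcomp _ _ fun _ => rfl).symm
  have hparam : ∀ u : P, 0 < a * (orderOf u : ℤ) ∧ 0 ≤ b * ((orderOf u).totient : ℤ) ∧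
      2 * (b * ((orderOf u).totient : ℤ)) ≤ a * (orderOf u : ℤ) := fun u => by
    have h1 : (0 : ℤ) < orderOf u := by exact_mod_cast orderOf_pos u
    have h2 : ((orderOf u).totient : ℤ) ≤ orderOf u := by exact_mod_cast Nat.totient_le _
    exact ⟨by positivity, by positivity, by nlinarith⟩
  have htotal : ∑ u : P, (a * (orderOf u : ℤ) * cyclicOrderSum (Nat.card H) -
      b * ((orderOf u).totient : ℤ) * cyclicTotientSum (Nat.card H)) =
      a * cyclicOrderSum n - b * cyclicTotientSum n := by
    have h1 := sum_orderWeight_of_isCyclic P (a * cyclicOrderSum (Nat.card H))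
      (b * cyclicTotientSum (Nat.card H))
    rw [← hPidx, cyclicOrderSum_mul hcop, cyclicTotientSum_mul hcop]
    push_cast
    convert h1 using 1
    · exact sum_congr rfl fun u _ => by rw [orderWeight]; ring
    · ring
  rw [hG, ← htotal]
  by_cases hH : IsCyclic H
  -- Here the fibre sums over `H` can be extremal, so strictness must come from one product of
  -- deficient order.
  · have hex : ∃ (u : P) (x : H), orderOf ((u : G) * x) ≠ orderOf u * orderOf x := by
      by_contra! hall
      exact hcyc (isCyclic_of_orderOf_mul_eq hcomp hall)
    obtain ⟨u₀, x₀, hne⟩ := hex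
    have hcycsum : ∀ u : P, ∑ x : H, orderWeight a b (orderOf u * orderOf x) =
        a * (orderOf u : ℤ) * cyclicOrderSum (Nat.card H) -
        b * ((orderOf u).totient : ℤ) * cyclicTotientSum (Nat.card H) := fun u => by
      rw [← sum_orderWeight_of_isCyclic H]
      exact sum_congr rfl fun x _ => hsplit u x
    refine sum_lt_sum (fun u _ => ?_) ⟨u₀, mem_univ _, ?_⟩
    · rw [← hcycsum]
      exact sum_le_sum fun x _ => orderWeight_le ha hb hab (hne0 u x) (hdvd u x)
    · rw [← hcycsum]
      exact sum_lt_sum (fun x _ => orderWeight_le ha hb hab (hne0 u₀ x) (hdvd u₀ x))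
        ⟨x₀, mem_univ _, orderWeight_lt ha hb hab (hne0 u₀ x₀) (hdvd u₀ x₀) hne⟩
  · refine sum_lt_sum_of_nonempty univ_nonempty fun u _ => ?_
    obtain ⟨h1, h2, h3⟩ := hparam u
    refine lt_of_le_of_lt ?_ (ih _ hHlt h1 h2 h3 rfl hH)
    exact sum_le_sum fun x _ => (orderWeight_le ha hb hab (hne0 u x) (hdvd u x)).trans_eq
      (hsplit u x)

/-! ### Counting edges of the power graph -/

theorem card_filter_mem_zpowers {G : Type*} [Group G] [Fintype G] (g : G)
    [DecidablePred (· ∈ Subgroup.zpowers g)] :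
    #{h : G | h ∈ Subgroup.zpowers g} = orderOf g := by
  rw [← Nat.card_zpowers, ← Fintype.card_subtype, Nat.card_eq_fintype_card]

theorem card_filter_mutual_zpowers {G : Type*} [Group G] [Fintype G] [DecidableEq G] (g : G)
    [DecidablePred fun h : G => h ∈ Subgroup.zpowers g ∧ g ∈ Subgroup.zpowers h] :
    #{h : G | h ∈ Subgroup.zpowers g ∧ g ∈ Subgroup.zpowers h} = (orderOf g).totient := by
  classical
  rw [← IsCyclic.card_orderOf_eq_totient (α := Subgroup.zpowers g) (d := orderOf g)
    (by rw [Fintype.card_zpowers])]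
  refine (card_bij (fun (h : Subgroup.zpowers g) _ => (h : G)) (fun h hh => ?_)
    (fun _ _ _ _ => Subtype.ext)
    fun h hh => ?_).symm
  · simp only [mem_filter, mem_univ, true_and, ← Subgroup.orderOf_coe] at hh ⊢
    refine ⟨h.2, ?_⟩
    have h1 : Subgroup.zpowers (h : G) = Subgroup.zpowers g :=
      Subgroup.eq_of_le_of_card_ge (Subgroup.zpowers_le.2 h.2)
        (by rw [Nat.card_zpowers, Nat.card_zpowers, hh])
    rw [h1]
    exact Subgroup.mem_zpowers g
  · simp only [mem_filter, mem_univ, true_and] at hh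
    refine ⟨⟨h, hh.1⟩, ?_, rfl⟩
    simp only [mem_filter, mem_univ, true_and, ← Subgroup.orderOf_coe]
    exact Nat.dvd_antisymm (orderOf_dvd_of_mem_zpowers hh.1) (orderOf_dvd_of_mem_zpowers hh.2)

/-- Inclusion-exclusion: the closed neighbourhood of `g` is the union of `{h | h ∈ ⟨g⟩}` and `{h | g
∈ ⟨h⟩}`, which meet in the `φ(o(g))` generators of `⟨g⟩`. Summed over `g`, both sets contribute
equally. -/
theorem two_mul_powerGraphEdgeCount {G : Type*} [Group G] [Fintype G] :
    (2 * powerGraphEdgeCount G + Nat.card G : ℤ) = ∑ g : G, orderWeight 2 1 (orderOf g) := by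
  classical
  have hE : 2 * powerGraphEdgeCount G = ∑ g : G, (powerGraph G).degree g := by
    rw [SimpleGraph.sum_degrees_eq_twice_card_edges, powerGraphEdgeCount,
      ← SimpleGraph.coe_edgeFinset, Set.ncard_coe_finset]
  have hdeg : ∀ g : G, (powerGraph G).degree g + 1 + #{h : G | h ∈ Subgroup.zpowers g ∧
      g ∈ Subgroup.zpowers h} = #{h : G | h ∈ Subgroup.zpowers g} +
      #{h : G | g ∈ Subgroup.zpowers h} := fun g => by
    have h1 : insert g ((powerGraph G).neighborFinset g) =
        ({h : G | h ∈ Subgroup.zpowers g} : Finset G) ∪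
          ({h : G | g ∈ Subgroup.zpowers h} : Finset G) := by
      ext h
      simp only [mem_insert, SimpleGraph.mem_neighborFinset, mem_union, mem_filter, mem_univ,
        true_and]
      simp only [powerGraph, directedPowerGraph]
      by_cases hg : h = g
      · subst hg
        simp
      · simp [hg, Ne.symm hg]
    rw [filter_and, ← card_union_add_card_inter, ← h1, card_insert_of_notMem (by simp),
      SimpleGraph.card_neighborFinset_eq_degree]
  have hswap : ∑ g : G, #{h : G | g ∈ Subgroup.zpowers h} =
      ∑ g : G, #{h : G | h ∈ Subgroup.zpowers g} := by
    simp only [card_filter]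
    exact sum_comm
  have hsum := sum_congr (rfl : (univ : Finset G) = univ) fun g _ => hdeg g
  rw [sum_add_distrib, sum_add_distrib, sum_add_distrib, ← hE, hswap] at hsum
  simp only [card_filter_mem_zpowers, card_filter_mutual_zpowers, sum_const, card_univ,
    smul_eq_mul, mul_one] at hsum
  rw [← Nat.card_eq_fintype_card] at hsum
  simp only [orderWeight, sum_sub_distrib, ← mul_sum, one_mul]
  zify at hsum
  linarith

/-- A finite group with as many power graph edges as a cyclic group of the same order is cyclic. -/
theorem isCyclic_of_powerGraphEdgeCount_eq {G C : Type*} [Group G] [Finite G] [Group C] [Finite C]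
    [IsCyclic C] (hcard : Nat.card G = Nat.card C)
    (h : powerGraphEdgeCount G = powerGraphEdgeCount C) : IsCyclic G := by
  have := Fintype.ofFinite G
  have := Fintype.ofFinite C
  by_contra hG
  have h1 := sum_orderWeight_lt (Nat.card G) (G := G) (a := 2) (b := 1) (by norm_num) (by norm_num)
    (by norm_num) rfl hG
  rw [hcard, ← sum_orderWeight_of_isCyclic C, ← two_mul_powerGraphEdgeCount,
    ← two_mul_powerGraphEdgeCount, h, hcard] at h1
  exact lt_irrefl _ h1

theorem powerGraphEdgeCount_eq_of_iso {G H : Type*} [Group G] [Group H]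
    (e : powerGraph G ≃g powerGraph H) : powerGraphEdgeCount G = powerGraphEdgeCount H :=
  Nat.card_congr e.mapEdgeSet

/-- A group isomorphism is an isomorphism of power graphs. -/
def powerGraphIsoOfMulEquiv {G H : Type*} [Group G] [Group H] (e : G ≃* H) :
    powerGraph G ≃g powerGraph H where
  toEquiv := e.toEquiv
  map_rel_iff' := by
    intro x y
    have h : ∀ x y : G, e y ∈ Subgroup.zpowers (e x) ↔ y ∈ Subgroup.zpowers x := fun x y => by
      simp only [Subgroup.mem_zpowers_iff, ← map_zpow, e.injective.eq_iff]
    simp [powerGraph, directedPowerGraph, h]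

theorem corollary1p4 {G : Type*} [Group G] [Finite G] (n : ℕ) (hn : 1 ≤ n) :
    (Nonempty (powerGraph G ≃g powerGraph (Multiplicative (ZMod n))) ↔
      Nonempty (G ≃* Multiplicative (ZMod n))) ∧
    (Nonempty (powerGraph G ≃g powerGraph (Multiplicative (ZMod n))) →
      powerGraphEdgeCount G = powerGraphEdgeCount (Multiplicative (ZMod n))) ∧
    (Nat.card G = n →
      List.TFAE [
        Nonempty (powerGraph G ≃g powerGraph (Multiplicative (ZMod n))),
        powerGraphEdgeCount G = powerGraphEdgeCount (Multiplicative (ZMod n)),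
        Nonempty (G ≃* Multiplicative (ZMod n))]) := by
  have : NeZero n := ⟨by omega⟩
  have : Finite (Multiplicative (ZMod n)) := inferInstanceAs (Finite (ZMod n))
  have hC : Nat.card (Multiplicative (ZMod n)) = n :=
    (Nat.card_congr Multiplicative.toAdd).trans (Nat.card_zmod n)
  have h12 : Nonempty (powerGraph G ≃g powerGraph (Multiplicative (ZMod n))) →
      powerGraphEdgeCount G = powerGraphEdgeCount (Multiplicative (ZMod n)) :=
    fun ⟨e⟩ => powerGraphEdgeCount_eq_of_iso e
  have h31 : Nonempty (G ≃* Multiplicative (ZMod n)) →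
      Nonempty (powerGraph G ≃g powerGraph (Multiplicative (ZMod n))) :=
    fun ⟨e⟩ => ⟨powerGraphIsoOfMulEquiv e⟩
  have h23 : Nat.card G = n →
      powerGraphEdgeCount G = powerGraphEdgeCount (Multiplicative (ZMod n)) →
      Nonempty (G ≃* Multiplicative (ZMod n)) := fun hG h => by
    have := isCyclic_of_powerGraphEdgeCount_eq (hG.trans hC.symm) h
    exact ⟨mulEquivOfCyclicCardEq (hG.trans hC.symm)⟩
  refine ⟨⟨fun h => h23 ?_ (h12 h), h31⟩, h12, fun hG => ?_⟩
  · obtain ⟨e⟩ := h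
    exact (Nat.card_congr e.toEquiv).trans hC
  · tfae_have 1 → 2 := h12
    tfae_have 2 → 3 := h23 hG
    tfae_have 3 → 1 := h31
    tfae_finish
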